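/- Let $n\ge 2$ and $1\le q<p<\infty$. For an open set $U\subset\mathbb R^n$, $W^{1,p}(U)$ denotes the space of locally integrable, weakly differentiable functions $u:U\to\mathbb R$ with $\|u\|_{W^{1,p}(U)}=\|u\|_{L^p(U)}+\|\nabla u\|_{L^p(U)}<\infty$. A bounded domain $\Omega\subset\mathbb R^n$ is a Sobolev $(p,q)$-extension domain if there is a (not necessarily linear) operator $E:W^{1,p}(\Omega)\to W^{1,q}(\mathbb R^n)$ with $E(u)|_\Omega= u$ for all $u\in W^{1,p}(\Omega)$ and $\sup_{u\ne 0}\|E(u)\|_{W^{1,q}(\mathbb R^n)}/\|u\|_{W^{1,p}(\Omega)}<\infty$. Write $B(x,r)$ for the open ball, $A(x;s,t)=B(x,t)\setminus B(x,s)$, and $|\cdot|$ for Lebesgue measure. For $E,F\subset \overline U$ let $$Cap_q(E,F;U)=\inf_u\int_U|\nabla u|^q\,dx,$$ where the infimum is over all functions $u:U\cup E\cup F\to\mathbb R$ with $u\in W^{1,q}(U)$ that are continuous at every point of $E\cup F$ and satisfy $u\ge 1$ on $E$ and $u\le 0$ on $F$ (for $E,F\subset U$ one may equivalently require $u\ge1$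 a.e. on a neighbourhood of $E$ and $u\le0$ a.e. on a neighbourhood of $F$). **Theorem.** Let $\Omega\subset\mathbb R^n$ be a Sobolev $(p,q)$-extension domain with $1\le q<p<\infty$. Then there exists a nonnegative, bounded, monotone and countably additive set function $\Phi$, defined on the open subsets of $\mathbb R^n$, such that for every $x\in\partial\Omega$ and each $0<r<\min\{1,\tfrac14\operatorname{diam}(\Omega)\}$, $$\Phi(B(x,r))^{p-q}\,|B(x,r)\cap\Omega|^q\ \ge\ r^{pq}\,Cap_q\!\left(\Omega\cap B\!\left(x,\tfrac r4\right),\ \Omega\cap A\!\left(x;\tfrac r2,\tfrac{3r}4\right);\ B(x,r)\right)^p .$$ Here "countably additive" means $\Phi(\bigcup_i U_i)=\sum_i\Phi(U_i)$ for every sequence of pairwise disjoint open sets $U_i$. -/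

import Mathlib

open MeasureTheory TopologicalSpace
open scoped ENNReal NNReal ContDiff

noncomputable section

/-- `g` is a weak gradient of `u` on `Ω ⊆ ℝⁿ`: both are locally integrable on `Ω`, and
`∫_Ω u ∂ᵢφ = - ∫_Ω gᵢ φ` for every coordinate `i` and every test function `φ ∈ C_c^∞(Ω)`. -/
structure HasWeakGradient {n : ℕ} (Ω : Set (EuclideanSpace ℝ (Fin n)))
    (u : EuclideanSpace ℝ (Fin n) → ℝ)
    (g : EuclideanSpace ℝ (Fin n) → EuclideanSpace ℝ (Fin n)) : Prop where
  locallyIntegrable : LocallyIntegrableOn u Ω volume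
  locallyIntegrable_grad : LocallyIntegrableOn g Ω volume
  integral_eq : ∀ φ : EuclideanSpace ℝ (Fin n) → ℝ, ContDiff ℝ ∞ φ → HasCompactSupport φ →
    tsupport φ ⊆ Ω → ∀ i : Fin n,
      ∫ x in Ω, u x * fderiv ℝ φ x (EuclideanSpace.single i 1) = - ∫ x in Ω, g x i * φ x

/-- The weak gradient of `u` on `Ω`, unique up to null sets in the open set `Ω`
(and `0` if there is none). -/
def weakGradient {n : ℕ} (Ω : Set (EuclideanSpace ℝ (Fin n)))
    (u : EuclideanSpace ℝ (Fin n) → ℝ) :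
    EuclideanSpace ℝ (Fin n) → EuclideanSpace ℝ (Fin n) :=
  open Classical in
  if h : ∃ g, HasWeakGradient Ω u g then h.choose else 0

/-- `u` (restricted to `Ω`) belongs to the Sobolev space `W^{1,p}(Ω)`. -/
structure MemW1 {n : ℕ} (p : ℝ) (Ω : Set (EuclideanSpace ℝ (Fin n)))
    (u : EuclideanSpace ℝ (Fin n) → ℝ) : Prop where
  memLp : MemLp u (ENNReal.ofReal p) (volume.restrict Ω)
  exists_weakGradient : ∃ g, HasWeakGradient Ω u g
  memLp_weakGradient : MemLp (weakGradient Ω u) (ENNReal.ofReal p) (volume.restrict Ω)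

/-- The norm `‖u‖_{L^p(Ω)} + ‖∇u‖_{L^p(Ω)}` of `W^{1,p}(Ω)`. -/
def normW1 {n : ℕ} (p : ℝ) (Ω : Set (EuclideanSpace ℝ (Fin n)))
    (u : EuclideanSpace ℝ (Fin n) → ℝ) : ℝ≥0∞ :=
  eLpNorm u (ENNReal.ofReal p) (volume.restrict Ω) +
    eLpNorm (weakGradient Ω u) (ENNReal.ofReal p) (volume.restrict Ω)

/-- `T` induces a bounded, not necessarily linear, extension operator
`W^{1,p}(Ω) → W^{1,q}(ℝⁿ)`; elements of these spaces are functions up to equality almost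
everywhere. -/
structure IsBoundedExtensionOperator {n : ℕ} (p q : ℝ) (Ω : Set (EuclideanSpace ℝ (Fin n)))
    (T : (EuclideanSpace ℝ (Fin n) → ℝ) → (EuclideanSpace ℝ (Fin n) → ℝ)) : Prop where
  congr : ∀ u v, MemW1 p Ω u → MemW1 p Ω v → u =ᵐ[volume.restrict Ω] v → T u =ᵐ[volume] T v
  mem : ∀ u, MemW1 p Ω u → MemW1 q Set.univ (T u)
  extends_self : ∀ u, MemW1 p Ω u → T u =ᵐ[volume.restrict Ω] u
  bounded : ∃ C : ℝ≥0, ∀ u, MemW1 p Ω u → normW1 p Ω u ≠ 0 →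
    normW1 q Set.univ (T u) ≤ C * normW1 p Ω u

/-- A Sobolev `(p,q)`-extension domain: a bounded domain with a bounded extension operator
`W^{1,p}(Ω) → W^{1,q}(ℝⁿ)`. -/
structure IsSobolevExtensionDomain {n : ℕ} (p q : ℝ) (Ω : Set (EuclideanSpace ℝ (Fin n))) :
    Prop where
  isOpen : IsOpen Ω
  isConnected : IsConnected Ω
  isBounded : Bornology.IsBounded Ω
  exists_extension : ∃ T, IsBoundedExtensionOperator p q Ω T

/-- Admissible functions for the condenser `(E, F)` in `U`: functions `u ∈ W^{1,q}(U)` that are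
continuous at every point of `E ∪ F` and satisfy `u ≥ 1` on `E`, `u ≤ 0` on `F`.
Up to a small change of `u`, this says that `u ≥ 1` on a neighbourhood of `E` and `u ≤ 0` on a
neighbourhood of `F`. -/
structure IsAdmissible {n : ℕ} (q : ℝ) (E F U : Set (EuclideanSpace ℝ (Fin n)))
    (u : EuclideanSpace ℝ (Fin n) → ℝ) : Prop where
  memW1 : MemW1 q U u
  continuousWithinAt : ∀ y ∈ E ∪ F, ContinuousWithinAt u (U ∪ E ∪ F) y
  one_le : ∀ y ∈ E, 1 ≤ u y
  le_zero : ∀ y ∈ F, u y ≤ 0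

/-- The variational `q`-capacity `Cap_q(E, F; U) = inf ∫_U |∇u|^q` of the condenser `(E, F)`
in `U`. -/
def variationalCapacity {n : ℕ} (q : ℝ) (E F U : Set (EuclideanSpace ℝ (Fin n))) : ℝ≥0∞ :=
  ⨅ (u : EuclideanSpace ℝ (Fin n) → ℝ) (_ : IsAdmissible q E F U u),
    ∫⁻ x in U, ‖weakGradient U u x‖ₑ ^ q

/-- The annulus `A(x; s, t) = B(x, t) \ B(x, s)`. -/
def annulus {n : ℕ} (x : EuclideanSpace ℝ (Fin n)) (s t : ℝ) : Set (EuclideanSpace ℝ (Fin n)) :=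
  Metric.ball x t \ Metric.ball x s

/-- The open ball `B(x, r)` as an open set. -/
def openBall {n : ℕ} (x : EuclideanSpace ℝ (Fin n)) (r : ℝ) : Opens (EuclideanSpace ℝ (Fin n)) :=
  ⟨Metric.ball x r, Metric.isOpen_ball⟩

/-- A nonnegative set function on open sets that is bounded, monotone and countably additive. -/
structure IsBoundedMonotoneAdditive {n : ℕ}
    (Φ : Opens (EuclideanSpace ℝ (Fin n)) → ℝ≥0∞) : Prop where
  bounded : ∃ M : ℝ≥0, ∀ U, Φ U ≤ M
  monotone : ∀ U V, U ≤ V → Φ U ≤ Φ V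
  iUnion : ∀ U : ℕ → Opens (EuclideanSpace ℝ (Fin n)),
    Pairwise (fun i j => Disjoint (U i : Set (EuclideanSpace ℝ (Fin n))) (U j)) →
      Φ (⨆ i, U i) = ∑' i, Φ (U i)

end

/-! Fix the domain. For a function u in W^{1,p}(Ω) vanishing off a compact subset of an open set U,
let e_U(u) be the least q-energy of the gradient in U among extensions of u from Ω ∩ U to U, and
S(u) = ∫_Ω |u|^p + |∇u|^p. Up to a constant factor, Φ(U) is the supremum of (e_U(u) /
S(u)^{q/p})^{p/(p-q)}, that is, the least t with e_U(u) ≤ t^{(p-q)/p} S(u)^{q/p} for all such u.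

Boundedness comes from the extension operator, and monotonicity from restricting extensions to
smaller sets. The exponent p/(p-q) is the one that makes Φ additive. For superadditivity
(`extensionSetFunction_add_le`), functions living in disjoint sets are rescaled so that e and S both
equal the respective quotient. Both quantities then add, and testing the sum on the union gives the
claim. For subadditivity (`extensionSetFunction_iUnion_le`), a compact support meets only finitely
many of the disjoint sets. Near-optimal extensions on these are glued, and Hölder's inequality with
exponents p/(p-q) and p/q finishes.

For the estimate, Φ is tested on a cutoff u equal to 1 on B(x,r/4) and 0 off the closed ball of
radius 3r/8. Any extension of u from Ω ∩ B(x,r) is, up to a null set, admissible for the condenser,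
so the capacity is at most e(u), while r^p S(u) ≤ C |B(x,r) ∩ Ω| because r < 1. The p-th power of
the defining inequality of Φ is the theorem, with C absorbed into Φ. -/

/-! ### Weak gradients: uniqueness, and restriction to relatively clopen pieces. -/

section WeakGradient

variable {n : ℕ}

local notation "E" => EuclideanSpace ℝ (Fin n)

/-- A locally integrable function times a continuous compactly supported one is integrable. -/
theorem LocallyIntegrableOn.integrableOn_mul_of_tsupport_subset {Ω : Set E} {f φ : E → ℝ}
    (hf : LocallyIntegrableOn f Ω volume) (hφ : Continuous φ) (hc : HasCompactSupport φ)
    (hs : tsupport φ ⊆ Ω) : IntegrableOn (fun x => f x * φ x) Ω volume := by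
  have h1 : IntegrableOn f (tsupport φ) volume := hf.integrableOn_compact_subset hs hc
  have h2 : IntegrableOn (fun x => f x * φ x) (tsupport φ) volume :=
    h1.mul_continuousOn hφ.continuousOn hc
  have h3 : Integrable (fun x => f x * φ x) volume := by
    rw [← integrableOn_iff_integrable_of_support_subset]
    · exact h2
    · intro x hx
      apply subset_tsupport
      simp only [Function.mem_support] at hx ⊢
      exact right_ne_zero_of_mul hx
  exact h3.integrableOn

theorem LocallyIntegrableOn.euclidean_apply {Ω : Set E} {g : E → E}
    (hg : LocallyIntegrableOn g Ω volume) (i : Fin n) :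
    LocallyIntegrableOn (fun x => g x i) Ω volume :=
  (EuclideanSpace.proj (𝕜 := ℝ) i).locallyIntegrableOn_comp hg

theorem continuous_fderiv_apply_of_contDiff {φ : E → ℝ} (hφ : ContDiff ℝ ∞ φ) (e : E) :
    Continuous (fun x => fderiv ℝ φ x e) :=
  (hφ.continuous_fderiv (by simp)).clm_apply continuous_const

theorem HasWeakGradient.integrableOn_mul_fderiv {Ω : Set E} {u : E → ℝ} {g : E → E}
    (h : HasWeakGradient Ω u g) {φ : E → ℝ} (hφ : ContDiff ℝ ∞ φ) (hc : HasCompactSupport φ)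
    (hs : tsupport φ ⊆ Ω) (e : E) :
    IntegrableOn (fun x => u x * fderiv ℝ φ x e) Ω volume :=
  LocallyIntegrableOn.integrableOn_mul_of_tsupport_subset h.locallyIntegrable
    (continuous_fderiv_apply_of_contDiff hφ e) (hc.fderiv_apply ℝ e)
    ((tsupport_fderiv_apply_subset ℝ e).trans hs)

theorem HasWeakGradient.integrableOn_apply_mul {Ω : Set E} {u : E → ℝ} {g : E → E}
    (h : HasWeakGradient Ω u g) {φ : E → ℝ} (hφ : ContDiff ℝ ∞ φ) (hc : HasCompactSupport φ)
    (hs : tsupport φ ⊆ Ω) (i : Fin n) :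
    IntegrableOn (fun x => g x i * φ x) Ω volume :=
  LocallyIntegrableOn.integrableOn_mul_of_tsupport_subset
    (LocallyIntegrableOn.euclidean_apply h.locallyIntegrable_grad i) hφ.continuous hc hs

theorem HasWeakGradient.zero (Ω : Set E) : HasWeakGradient Ω (0 : E → ℝ) 0 where
  locallyIntegrable := locallyIntegrableOn_zero
  locallyIntegrable_grad := locallyIntegrableOn_zero
  integral_eq := by intros; simp

theorem HasWeakGradient.add {Ω : Set E} {u v : E → ℝ} {g k : E → E}
    (h : HasWeakGradient Ω u g) (h' : HasWeakGradient Ω v k) :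
    HasWeakGradient Ω (u + v) (g + k) where
  locallyIntegrable := h.locallyIntegrable.add h'.locallyIntegrable
  locallyIntegrable_grad := h.locallyIntegrable_grad.add h'.locallyIntegrable_grad
  integral_eq := by
    intro φ hφ hc hs i
    have e1 := h.integral_eq φ hφ hc hs i
    have e2 := h'.integral_eq φ hφ hc hs i
    simp only [Pi.add_apply, PiLp.add_apply, add_mul]
    rw [integral_add (h.integrableOn_mul_fderiv hφ hc hs _) (h'.integrableOn_mul_fderiv hφ hc hs _),
      integral_add (h.integrableOn_apply_mul hφ hc hs i) (h'.integrableOn_apply_mul hφ hc hs i),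
      e1, e2]
    ring

theorem HasWeakGradient.const_smul {Ω : Set E} {u : E → ℝ} {g : E → E}
    (h : HasWeakGradient Ω u g) (c : ℝ) :
    HasWeakGradient Ω (c • u) (c • g) where
  locallyIntegrable := h.locallyIntegrable.smul c
  locallyIntegrable_grad := h.locallyIntegrable_grad.smul c
  integral_eq := by
    intro φ hφ hc hs i
    simp only [Pi.smul_apply, PiLp.smul_apply, smul_eq_mul, mul_assoc]
    rw [integral_const_mul, integral_const_mul, h.integral_eq φ hφ hc hs i]
    ring

theorem HasWeakGradient.finsetSum {ι : Type*} {Ω : Set E} (s : Finset ι) {u : ι → E → ℝ}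
    {g : ι → E → E} (h : ∀ i ∈ s, HasWeakGradient Ω (u i) (g i)) :
    HasWeakGradient Ω (∑ i ∈ s, u i) (∑ i ∈ s, g i) := by
  classical
  induction s using Finset.induction_on with
  | empty => simpa using HasWeakGradient.zero Ω
  | insert a s ha ih =>
    rw [Finset.sum_insert ha, Finset.sum_insert ha]
    exact (h a (Finset.mem_insert_self _ _)).add
      (ih fun i hi => h i (Finset.mem_insert_of_mem hi))

theorem HasWeakGradient.mono {Ω U : Set E} {u : E → ℝ} {g : E → E}
    (h : HasWeakGradient Ω u g) (hΩ : MeasurableSet Ω) (hU : U ⊆ Ω) :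
    HasWeakGradient U u g where
  locallyIntegrable := h.locallyIntegrable.mono_set hU
  locallyIntegrable_grad := h.locallyIntegrable_grad.mono_set hU
  integral_eq := by
    intro φ hφ hc hs i
    have e := h.integral_eq φ hφ hc (hs.trans hU) i
    rw [setIntegral_eq_of_subset_of_forall_sdiff_eq_zero hΩ hU,
      setIntegral_eq_of_subset_of_forall_sdiff_eq_zero hΩ hU] at e
    · exact e
    · intro x hx
      rw [image_eq_zero_of_notMem_tsupport (fun hx' => hx.2 (hs hx')), mul_zero]
    · intro x hx
      have : fderiv ℝ φ x (EuclideanSpace.single i 1) = 0 :=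
        image_eq_zero_of_notMem_tsupport (f := fun x => fderiv ℝ φ x (EuclideanSpace.single i 1))
          (fun hx' => hx.2 (hs (tsupport_fderiv_apply_subset ℝ _ hx')))
      rw [this, mul_zero]

/-- The fundamental lemma of the calculus of variations, applied to each coordinate of the
difference. It allows explicit gradients to replace the chosen `weakGradient`. -/
theorem HasWeakGradient.ae_eq {Ω : Set E} (hΩ : IsOpen Ω) {u v : E → ℝ} {g k : E → E}
    (h : HasWeakGradient Ω u g) (h' : HasWeakGradient Ω v k)
    (huv : u =ᵐ[volume.restrict Ω] v) : g =ᵐ[volume.restrict Ω] k := by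
  have key : ∀ i : Fin n, ∀ᵐ x ∂volume.restrict Ω, g x i = k x i := by
    intro i
    have h1 : LocallyIntegrableOn (fun x => g x i - k x i) Ω volume :=
      (LocallyIntegrableOn.euclidean_apply h.locallyIntegrable_grad i).sub
        (LocallyIntegrableOn.euclidean_apply h'.locallyIntegrable_grad i)
    have h2 := hΩ.ae_eq_zero_of_integral_contDiff_smul_eq_zero h1 (μ := volume) (by
      intro φ hφ hc hs
      have e1 := h.integral_eq φ hφ hc hs i
      have e2 := h'.integral_eq φ hφ hc hs i
      have e3 : ∫ x in Ω, u x * fderiv ℝ φ x (EuclideanSpace.single i 1)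
          = ∫ x in Ω, v x * fderiv ℝ φ x (EuclideanSpace.single i 1) := by
        apply integral_congr_ae
        filter_upwards [huv] with x hx
        rw [hx]
      have e4 : ∫ x in Ω, φ x • (g x i - k x i) = ∫ x, φ x • (g x i - k x i) := by
        apply setIntegral_eq_integral_of_forall_compl_eq_zero
        intro x hx
        rw [image_eq_zero_of_notMem_tsupport (fun hx' => hx (hs hx')), zero_smul]
      rw [← e4]
      have e5 : ∀ x, φ x • (g x i - k x i) = g x i * φ x - k x i * φ x := by
        intro x; simp only [smul_eq_mul]; ring
      simp only [e5]
      rw [integral_sub (h.integrableOn_apply_mul hφ hc hs i)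
        (h'.integrableOn_apply_mul hφ hc hs i)]
      linarith)
    rw [ae_restrict_iff' hΩ.measurableSet]
    filter_upwards [h2] with x hx hxΩ
    exact sub_eq_zero.mp (hx hxΩ)
  filter_upwards [ae_all_iff.mpr key] with x hx
  ext i
  exact hx i

theorem hasWeakGradient_weakGradient {Ω : Set E} {u : E → ℝ} (h : ∃ g, HasWeakGradient Ω u g) :
    HasWeakGradient Ω u (weakGradient Ω u) := by
  classical
  unfold weakGradient
  rw [dif_pos h]
  exact h.choose_spec

theorem HasWeakGradient.weakGradient_ae_eq {Ω : Set E} (hΩ : IsOpen Ω) {u : E → ℝ} {g : E → E}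
    (h : HasWeakGradient Ω u g) : weakGradient Ω u =ᵐ[volume.restrict Ω] g :=
  (hasWeakGradient_weakGradient ⟨g, h⟩).ae_eq hΩ h (Filter.EventuallyEq.refl _ _)

theorem HasWeakGradient.congr {Ω : Set E} {u v : E → ℝ} {g : E → E}
    (h : HasWeakGradient Ω u g) (huv : u =ᵐ[volume.restrict Ω] v) :
    HasWeakGradient Ω v g where
  locallyIntegrable := h.locallyIntegrable.congr huv
  locallyIntegrable_grad := h.locallyIntegrable_grad
  integral_eq := by
    intro φ hφ hc hs i
    rw [← h.integral_eq φ hφ hc hs i]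
    apply integral_congr_ae
    filter_upwards [huv] with x hx
    rw [hx]

theorem LocallyIntegrableOn.indicator_of_measurableSet {F : Type*} [NormedAddCommGroup F]
    {Ω V : Set E} {f : E → F} (hf : LocallyIntegrableOn f Ω volume) (hV : MeasurableSet V) :
    LocallyIntegrableOn (V.indicator f) Ω volume := by
  intro x hx
  obtain ⟨t, ht, hi⟩ := hf x hx
  exact ⟨t, ht, hi.indicator hV⟩

theorem LocallyIntegrableOn.indicator_of_isOpen_sdiff {F : Type*} [NormedAddCommGroup F]
    {U V : Set E} {f : E → F} (hf : LocallyIntegrableOn f V volume) (hV : IsOpen V)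
    (hUV : IsOpen (U \ V)) :
    LocallyIntegrableOn (V.indicator f) U volume := by
  intro x hx
  by_cases hxV : x ∈ V
  · obtain ⟨t, ht, hi⟩ := hf x hxV
    rw [hV.nhdsWithin_eq hxV] at ht
    exact ⟨t, mem_nhdsWithin_of_mem_nhds ht, hi.indicator hV.measurableSet⟩
  · refine ⟨U \ V, mem_nhdsWithin_of_mem_nhds (hUV.mem_nhds ⟨hx, hxV⟩), ?_⟩
    refine (integrableOn_zero (ε' := F)).congr_fun_ae ?_
    filter_upwards [ae_restrict_mem hUV.measurableSet] with y hy
    simp [Set.indicator_of_notMem hy.2]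

/-- Extension by zero of a weakly differentiable function to a larger open set in which its
domain is relatively clopen. -/
theorem HasWeakGradient.indicator_of_isOpen_sdiff {U V : Set E} {u : E → ℝ} {g : E → E}
    (h : HasWeakGradient V u g) (hV : IsOpen V) (hVU : V ⊆ U) (hUV : IsOpen (U \ V)) :
    HasWeakGradient U (V.indicator u) (V.indicator g) where
  locallyIntegrable :=
    LocallyIntegrableOn.indicator_of_isOpen_sdiff h.locallyIntegrable hV hUV
  locallyIntegrable_grad :=
    LocallyIntegrableOn.indicator_of_isOpen_sdiff h.locallyIntegrable_grad hV hUV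
  integral_eq := by
    intro φ hφ hc hs i
    -- Since `U \ V` is open, this intersection is closed, so cutting φ off to V leaves a smooth
    -- compactly supported test function on V.
    have hclosed : tsupport φ ∩ V = tsupport φ \ (U \ V) := by
      ext x
      constructor
      · rintro ⟨h1, h2⟩; exact ⟨h1, fun h3 => h3.2 h2⟩
      · rintro ⟨h1, h2⟩; exact ⟨h1, by_contra fun h3 => h2 ⟨hs h1, h3⟩⟩
    have hcl : IsClosed (tsupport φ ∩ V) := by
      rw [hclosed]; exact (isClosed_tsupport φ).sdiff hUV
    have hts : tsupport (V.indicator φ) ⊆ tsupport φ ∩ V := by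
      apply closure_minimal _ hcl
      intro x hx
      rw [Function.mem_support, Set.indicator_apply_ne_zero] at hx
      exact ⟨subset_tsupport _ hx.2, hx.1⟩
    have hcs : HasCompactSupport (V.indicator φ) :=
      hc.of_isClosed_subset (isClosed_tsupport _) (hts.trans Set.inter_subset_left)
    have hsm : ContDiff ℝ ∞ (V.indicator φ) := by
      rw [contDiff_iff_contDiffAt]
      intro x
      by_cases hx : x ∈ V
      · refine hφ.contDiffAt.congr_of_eventuallyEq ?_
        filter_upwards [hV.mem_nhds hx] with y hy
        rw [Set.indicator_of_mem hy]
      · refine (contDiffAt_const (c := (0 : ℝ))).congr_of_eventuallyEq ?_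
        filter_upwards [hcl.isOpen_compl.mem_nhds (fun h' => hx h'.2)] with y hy
        exact image_eq_zero_of_notMem_tsupport fun h' => hy (hts h')
    have e := h.integral_eq _ hsm hcs (hts.trans Set.inter_subset_right) i
    have e1 : ∫ x in V, u x * fderiv ℝ (V.indicator φ) x (EuclideanSpace.single i 1)
        = ∫ x in V, u x * fderiv ℝ φ x (EuclideanSpace.single i 1) := by
      refine setIntegral_congr_fun hV.measurableSet ?_
      intro x hx
      have : V.indicator φ =ᶠ[nhds x] φ := by
        filter_upwards [hV.mem_nhds hx] with y hy
        rw [Set.indicator_of_mem hy]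
      simp only [this.fderiv_eq]
    have e2 : ∫ x in V, g x i * V.indicator φ x = ∫ x in V, g x i * φ x := by
      refine setIntegral_congr_fun hV.measurableSet ?_
      intro x hx
      simp only [Set.indicator_of_mem hx]
    rw [e1, e2] at e
    have e3 : ∀ f : E → ℝ, ∫ x in U, V.indicator f x = ∫ x in V, f x := by
      intro f
      rw [setIntegral_indicator hV.measurableSet, Set.inter_eq_self_of_subset_right hVU]
    rw [← e3, ← e3] at e
    convert e using 2
    · ext x
      by_cases hx : x ∈ V <;> simp [hx]
    · congr 1
      ext x
      by_cases hx : x ∈ V <;> simp [hx]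

/-- Restriction of a weakly differentiable function to the part of its compact support inside an
open set, when that part is closed. -/
theorem HasWeakGradient.indicator_of_isCompact {Ω V K : Set E} {u : E → ℝ} {g : E → E}
    (h : HasWeakGradient Ω u g) (hV : IsOpen V) (hK : IsCompact K) (hKV : IsClosed (K ∩ V))
    (hu : ∀ x ∉ K, u x = 0) (hg : ∀ x ∉ K, g x = 0) :
    HasWeakGradient Ω (V.indicator u) (V.indicator g) where
  locallyIntegrable :=
    LocallyIntegrableOn.indicator_of_measurableSet h.locallyIntegrable hV.measurableSet
  locallyIntegrable_grad :=
    LocallyIntegrableOn.indicator_of_measurableSet h.locallyIntegrable_grad hV.measurableSet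
  integral_eq := by
    have hd : Disjoint (K \ V) (K ∩ V) :=
      Set.disjoint_left.mpr fun x hx hx' => hx.2 hx'.2
    -- The sharp cutoff by V is replaced by a smooth χ that is 1 near `K ∩ V` and 0 near `K \ V`.
    -- Testing with χφ gives the identity, because u and g vanish off K.
    obtain ⟨χ, h0, h1, -⟩ := exists_contMDiffMap_zero_one_nhds_of_isClosed
      (n := ⊤) (modelWithCornersSelf ℝ E) (hK.isClosed.sdiff hV) hKV hd
    have hχ : ContDiff ℝ ∞ χ := χ.contMDiff.contDiff
    intro φ hφ hc hs i
    have hts : tsupport (fun x => χ x * φ x) ⊆ tsupport φ := tsupport_mul_subset_right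
    have e := h.integral_eq (fun x => χ x * φ x) (hχ.mul hφ)
      (hc.mul_left) (hts.trans hs) i
    convert e using 2
    · ext x
      by_cases hx : x ∈ K
      · by_cases hxV : x ∈ V
        · have h2 : (fun x => χ x * φ x) =ᶠ[nhds x] φ := by
            filter_upwards [h1.filter_mono (nhds_le_nhdsSet (show x ∈ K ∩ V from ⟨hx, hxV⟩))]
              with y hy
            rw [hy, one_mul]
          rw [h2.fderiv_eq, Set.indicator_of_mem hxV]
        · have h2 : (fun x => χ x * φ x) =ᶠ[nhds x] fun _ => 0 := by
            filter_upwards [h0.filter_mono (nhds_le_nhdsSet (show x ∈ K \ V from ⟨hx, hxV⟩))]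
              with y hy
            rw [hy, zero_mul]
          rw [h2.fderiv_eq, Set.indicator_of_notMem hxV]
          simp
      · by_cases hxV : x ∈ V <;> simp [hu x hx, hxV]
    · congr 1
      ext x
      by_cases hx : x ∈ K
      · by_cases hxV : x ∈ V
        · have h2 := (h1.filter_mono (nhds_le_nhdsSet (show x ∈ K ∩ V from ⟨hx, hxV⟩))).self_of_nhds
          rw [h2, one_mul, Set.indicator_of_mem hxV]
        · have h2 := (h0.filter_mono (nhds_le_nhdsSet (show x ∈ K \ V from ⟨hx, hxV⟩))).self_of_nhds
          rw [h2, Set.indicator_of_notMem hxV]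
          simp
      · by_cases hxV : x ∈ V <;> simp [hg x hx, hxV]

theorem EuclideanSpace.gradient_apply (u : E → ℝ) (x : E) (i : Fin n) :
    gradient u x i = fderiv ℝ u x (EuclideanSpace.single i 1) := by
  have h1 := EuclideanSpace.inner_single_right i (1 : ℝ) (gradient u x)
  have h2 : inner ℝ (gradient u x) (EuclideanSpace.single i 1)
      = fderiv ℝ u x (EuclideanSpace.single i 1) := InnerProductSpace.toDual_symm_apply
  rw [← h2, h1]
  simp

/-- The classical gradient of a smooth compactly supported function is a weak gradient. -/
theorem hasWeakGradient_gradient (Ω : Set E) {u : E → ℝ} (hu : ContDiff ℝ ∞ u)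
    (hcu : HasCompactSupport u) :
    HasWeakGradient Ω u (gradient u) := by
  have hgc : Continuous (gradient u) := by
    unfold gradient
    exact (InnerProductSpace.toDual ℝ E).symm.continuous.comp (hu.continuous_fderiv (by simp))
  refine HasWeakGradient.mono (Ω := Set.univ) ?_ MeasurableSet.univ (Set.subset_univ _)
  refine ⟨(hu.continuous.locallyIntegrable).locallyIntegrableOn _,
    hgc.locallyIntegrable.locallyIntegrableOn _, ?_⟩
  intro φ hφ hc hs i
  simp only [EuclideanSpace.gradient_apply, Measure.restrict_univ]
  have c1 := continuous_fderiv_apply_of_contDiff hu (EuclideanSpace.single i 1)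
  have c2 := continuous_fderiv_apply_of_contDiff hφ (EuclideanSpace.single i 1)
  apply integral_mul_fderiv_eq_neg_fderiv_mul_of_integrable
  · exact (c1.mul hφ.continuous).integrable_of_hasCompactSupport (hc.mul_left)
  · exact (hu.continuous.mul c2).integrable_of_hasCompactSupport (hcu.mul_right)
  · exact (hu.continuous.mul hφ.continuous).integrable_of_hasCompactSupport (hc.mul_left)
  · exact fun x _ => hu.differentiable (by simp) x
  · exact fun x _ => hφ.differentiable (by simp) x

end WeakGradient

/-! ### The extension energy: monotonicity, homogeneity and behaviour on disjoint unions. -/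

noncomputable section SetFunction

variable {n : ℕ}

local notation "E" => EuclideanSpace ℝ (Fin n)

/-- `u` is a function in `W^{1,p}(Ω)` with weak gradient `g`, vanishing off a compact subset
of `U`. -/
structure IsTestPair (p : ℝ) (Ω U : Set (EuclideanSpace ℝ (Fin n)))
    (u : EuclideanSpace ℝ (Fin n) → ℝ)
    (g : EuclideanSpace ℝ (Fin n) → EuclideanSpace ℝ (Fin n)) : Prop where
  hasWeakGradient : HasWeakGradient Ω u g
  memLp : MemLp u (ENNReal.ofReal p) (volume.restrict Ω)
  memLp_grad : MemLp g (ENNReal.ofReal p) (volume.restrict Ω)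
  exists_isCompact : ∃ K, IsCompact K ∧ K ⊆ U ∧ (∀ x ∉ K, u x = 0) ∧ ∀ x ∉ K, g x = 0

/-- The least `q`-energy in `U` of an extension to `U` of the restriction of `u` to `Ω ∩ U`. -/
def extensionEnergy (q : ℝ) (Ω U : Set (EuclideanSpace ℝ (Fin n)))
    (u : EuclideanSpace ℝ (Fin n) → ℝ) : ℝ≥0∞ :=
  ⨅ (v : EuclideanSpace ℝ (Fin n) → ℝ)
    (g : EuclideanSpace ℝ (Fin n) → EuclideanSpace ℝ (Fin n))
    (_ : HasWeakGradient U v g ∧ MemLp v (ENNReal.ofReal q) (volume.restrict U) ∧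
      v =ᵐ[volume.restrict (Ω ∩ U)] u),
    ∫⁻ x in U, ‖g x‖ₑ ^ q

/-- The energy `∫_Ω |u|^p + |g|^p`. -/
def sobolevEnergy (p : ℝ) (Ω : Set (EuclideanSpace ℝ (Fin n)))
    (u : EuclideanSpace ℝ (Fin n) → ℝ)
    (g : EuclideanSpace ℝ (Fin n) → EuclideanSpace ℝ (Fin n)) : ℝ≥0∞ :=
  ∫⁻ x in Ω, (‖u x‖ₑ ^ p + ‖g x‖ₑ ^ p)

/-- The largest quotient of the extension energy by the Sobolev energy, suitably normalised, over
all functions supported in `U`. -/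
def extensionSetFunction (p q : ℝ) (Ω U : Set (EuclideanSpace ℝ (Fin n))) : ℝ≥0∞ :=
  ⨆ (u : EuclideanSpace ℝ (Fin n) → ℝ)
    (g : EuclideanSpace ℝ (Fin n) → EuclideanSpace ℝ (Fin n)) (_ : IsTestPair p Ω U u g),
    (extensionEnergy q Ω U u / sobolevEnergy p Ω u g ^ (q / p)) ^ (p / (p - q))

variable {p q : ℝ} {Ω U V : Set (EuclideanSpace ℝ (Fin n))} {u v w : EuclideanSpace ℝ (Fin n) → ℝ}
  {g k : EuclideanSpace ℝ (Fin n) → EuclideanSpace ℝ (Fin n)}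

theorem extensionEnergy_le (h : HasWeakGradient U v g)
    (hv : MemLp v (ENNReal.ofReal q) (volume.restrict U))
    (huv : v =ᵐ[volume.restrict (Ω ∩ U)] u) :
    extensionEnergy q Ω U u ≤ ∫⁻ x in U, ‖g x‖ₑ ^ q :=
  iInf_le_of_le v (iInf_le_of_le g (iInf_le_of_le ⟨h, hv, huv⟩ le_rfl))

theorem le_extensionEnergy {a : ℝ≥0∞}
    (h : ∀ v g, HasWeakGradient U v g → MemLp v (ENNReal.ofReal q) (volume.restrict U) →
      v =ᵐ[volume.restrict (Ω ∩ U)] u → a ≤ ∫⁻ x in U, ‖g x‖ₑ ^ q) :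
    a ≤ extensionEnergy q Ω U u :=
  le_iInf fun v => le_iInf fun g => le_iInf fun hv => h v g hv.1 hv.2.1 hv.2.2

theorem exists_of_extensionEnergy_lt {a : ℝ≥0∞} (h : extensionEnergy q Ω U u < a) :
    ∃ v g, HasWeakGradient U v g ∧ MemLp v (ENNReal.ofReal q) (volume.restrict U) ∧
      v =ᵐ[volume.restrict (Ω ∩ U)] u ∧ ∫⁻ x in U, ‖g x‖ₑ ^ q < a := by
  simp only [extensionEnergy, iInf_lt_iff] at h
  obtain ⟨v, g, ⟨h1, h2, h3⟩, h4⟩ := h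
  exact ⟨v, g, h1, h2, h3, h4⟩

theorem extensionEnergy_congr_le (hΩ : MeasurableSet Ω) (hU : MeasurableSet U)
    (h : Set.EqOn u v U) : extensionEnergy q Ω U u ≤ extensionEnergy q Ω U v := by
  refine le_extensionEnergy fun f g hf hfL hfv => extensionEnergy_le hf hfL ?_
  filter_upwards [hfv, ae_restrict_mem (hΩ.inter hU)] with x hx hxU
  rw [hx, h hxU.2]

theorem extensionEnergy_mono (hV : MeasurableSet V) (hUV : U ⊆ V) :
    extensionEnergy q Ω U u ≤ extensionEnergy q Ω V u := by
  refine le_extensionEnergy fun f g hf hfL hfv => ?_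
  refine (extensionEnergy_le (hf.mono hV hUV)
    (hfL.mono_measure (Measure.restrict_mono_set _ hUV)) ?_).trans
    (lintegral_mono_set hUV)
  exact ae_restrict_of_ae_restrict_of_subset (Set.inter_subset_inter_right _ hUV) hfv

theorem extensionEnergy_eq_zero (hq : 0 < q) (hu : u =ᵐ[volume.restrict (Ω ∩ U)] 0) :
    extensionEnergy q Ω U u = 0 := by
  refine le_antisymm ((extensionEnergy_le (HasWeakGradient.zero U) MemLp.zero hu.symm).trans ?_)
    zero_le
  simp [ENNReal.zero_rpow_of_pos hq]

/-- Homogeneity of degree q: dividing an extension of c • u by c gives a competitor for u. -/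
theorem rpow_mul_extensionEnergy_le {c : ℝ} (hc : 0 < c) (hq : 0 ≤ q)
    (h : HasWeakGradient U v g) (hv : MemLp v (ENNReal.ofReal q) (volume.restrict U))
    (huv : v =ᵐ[volume.restrict (Ω ∩ U)] c • u) :
    ENNReal.ofReal c ^ q * extensionEnergy q Ω U u ≤ ∫⁻ x in U, ‖g x‖ₑ ^ q := by
  have hc0 : ENNReal.ofReal c ^ q ≠ ⊤ := ENNReal.rpow_ne_top_of_nonneg hq ENNReal.ofReal_ne_top
  have h1 : extensionEnergy q Ω U u ≤ ∫⁻ x in U, ‖(c⁻¹ • g) x‖ₑ ^ q := by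
    refine extensionEnergy_le (h.const_smul c⁻¹) (hv.const_smul c⁻¹) ?_
    filter_upwards [huv] with x hx
    simp [hx, hc.ne']
  calc ENNReal.ofReal c ^ q * extensionEnergy q Ω U u
      ≤ ENNReal.ofReal c ^ q * ∫⁻ x in U, ‖(c⁻¹ • g) x‖ₑ ^ q := by gcongr
    _ = ∫⁻ x in U, ENNReal.ofReal c ^ q * ‖(c⁻¹ • g) x‖ₑ ^ q :=
        (lintegral_const_mul' _ _ hc0).symm
    _ = ∫⁻ x in U, ‖g x‖ₑ ^ q := by
        congr 1
        ext x
        rw [← ENNReal.mul_rpow_of_nonneg _ _ hq, Pi.smul_apply,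
          ← Real.enorm_of_nonneg hc.le, ← enorm_smul, smul_inv_smul₀ hc.ne']

/-- An extension on the union restricts to an extension on each piece, and the integral splits. On
each piece only one summand is nonzero. -/
theorem extensionEnergy_add_le {c d : ℝ} (hc : 0 < c) (hd : 0 < d) (hq : 0 ≤ q)
    (hΩ : MeasurableSet Ω) (hU : IsOpen U) (hV : IsOpen V) (hUV : Disjoint U V)
    (hu : ∀ x ∈ V, u x = 0) (hw : ∀ x ∈ U, w x = 0) :
    ENNReal.ofReal c ^ q * extensionEnergy q Ω U u + ENNReal.ofReal d ^ q * extensionEnergy q Ω V w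
      ≤ extensionEnergy q Ω (U ∪ V) (c • u + d • w) := by
  have hm := hU.measurableSet.union hV.measurableSet
  refine le_extensionEnergy fun f g hf hfL hfv => ?_
  rw [lintegral_union hV.measurableSet hUV]
  refine add_le_add ?_ ?_
  · refine rpow_mul_extensionEnergy_le hc hq (hf.mono hm Set.subset_union_left)
      (hfL.mono_measure (Measure.restrict_mono_set _ Set.subset_union_left)) ?_
    filter_upwards [ae_restrict_of_ae_restrict_of_subset
      (Set.inter_subset_inter_right _ Set.subset_union_left) hfv,
      ae_restrict_mem (hΩ.inter hU.measurableSet)] with x hx hxU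
    simp [hx, hw x hxU.2]
  · refine rpow_mul_extensionEnergy_le hd hq (hf.mono hm Set.subset_union_right)
      (hfL.mono_measure (Measure.restrict_mono_set _ Set.subset_union_right)) ?_
    filter_upwards [ae_restrict_of_ae_restrict_of_subset
      (Set.inter_subset_inter_right _ Set.subset_union_right) hfv,
      ae_restrict_mem (hΩ.inter hV.measurableSet)] with x hx hxU
    simp [hx, hu x hxU.2]

theorem Finset.sum_indicator_apply_of_mem {ι α M : Type*} [AddCommMonoid M] [DecidableEq ι]
    (s : Finset ι)
    (U : ι → Set α) (hU : Pairwise fun i j => Disjoint (U i) (U j)) (f : ι → α → M) {j : ι} {x : α}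
    (hx : x ∈ U j) :
    (∑ i ∈ s, (U i).indicator (f i)) x = if j ∈ s then f j x else 0 := by
  rw [Finset.sum_apply]
  have h : ∀ i ∈ s, (U i).indicator (f i) x = if j = i then f j x else 0 := by
    intro i _
    by_cases hij : j = i
    · subst hij; simp [hx]
    · rw [if_neg hij, Set.indicator_of_notMem]
      exact Set.disjoint_left.mp (hU hij) hx
  rw [Finset.sum_congr rfl h, Finset.sum_ite_eq]

/-- Near-minimisers on the finitely many pieces where u may be nonzero are glued together, with zero
on all other pieces. No compatibility is needed, as the pieces are disjoint and open. -/
theorem extensionEnergy_iUnion_le (hq : 0 < q) (hΩ : MeasurableSet Ω) {U : ℕ → Set E}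
    (hU : ∀ i, IsOpen (U i)) (hd : Pairwise fun i j => Disjoint (U i) (U j)) (F : Finset ℕ)
    (hF : ∀ i ∉ F, ∀ x ∈ U i, u x = 0) :
    extensionEnergy q Ω (⋃ i, U i) u ≤ ∑ i ∈ F, extensionEnergy q Ω (U i) u := by
  classical
  have h0 : ∀ i ∉ F, extensionEnergy q Ω (U i) u = 0 := by
    intro i hi
    apply extensionEnergy_eq_zero hq
    filter_upwards [ae_restrict_mem (hΩ.inter (hU i).measurableSet)] with x hx
    exact hF i hi x hx.2
  by_cases htop : ∃ i ∈ F, extensionEnergy q Ω (U i) u = ⊤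
  · rw [ENNReal.sum_eq_top.mpr htop]; exact le_top
  push Not at htop
  have hfin : ∀ i, extensionEnergy q Ω (U i) u ≠ ⊤ := by
    intro i
    by_cases hi : i ∈ F
    · exact htop i hi
    · rw [h0 i hi]; exact ENNReal.zero_ne_top
  refine ENNReal.le_of_forall_pos_le_add fun ε hε _ => ?_
  obtain ⟨δ, hδ, hδs⟩ := ENNReal.exists_pos_sum_of_countable (ENNReal.coe_ne_zero.mpr hε.ne') ℕ
  have hex : ∀ i, ∃ v g, HasWeakGradient (U i) v g ∧
      MemLp v (ENNReal.ofReal q) (volume.restrict (U i)) ∧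
      v =ᵐ[volume.restrict (Ω ∩ U i)] u ∧
      ∫⁻ x in U i, ‖g x‖ₑ ^ q < extensionEnergy q Ω (U i) u + δ i := fun i =>
    exists_of_extensionEnergy_lt
      (ENNReal.lt_add_right (hfin i) (ENNReal.coe_ne_zero.mpr (hδ i).ne'))
  choose v g hvg hvL hvu hge using hex
  have hsub : ∀ i, U i ⊆ ⋃ j, U j := fun i => Set.subset_iUnion U i
  -- Each piece is relatively clopen in the union, so extension by zero preserves weak
  -- differentiability.
  have hdiff : ∀ i, IsOpen ((⋃ j, U j) \ U i) := by
    intro i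
    have : (⋃ j, U j) \ U i = ⋃ j, ⋃ (_ : j ≠ i), U j := by
      ext x
      simp only [Set.mem_sdiff, Set.mem_iUnion, exists_prop]
      constructor
      · rintro ⟨⟨j, hj⟩, hx⟩
        exact ⟨j, fun h => hx (h ▸ hj), hj⟩
      · rintro ⟨j, hji, hj⟩
        exact ⟨⟨j, hj⟩, Set.disjoint_left.mp (hd hji) hj⟩
    rw [this]
    exact isOpen_iUnion fun j => isOpen_iUnion fun _ => hU j
  calc extensionEnergy q Ω (⋃ i, U i) u
      ≤ ∫⁻ x in ⋃ i, U i, ‖(∑ i ∈ F, (U i).indicator (g i)) x‖ₑ ^ q := by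
        refine extensionEnergy_le (v := ∑ i ∈ F, (U i).indicator (v i)) ?_ ?_ ?_
        · exact HasWeakGradient.finsetSum F fun i _ =>
            (hvg i).indicator_of_isOpen_sdiff (hU i) (hsub i) (hdiff i)
        · refine memLp_finsetSum' F fun i _ => ?_
          rw [memLp_indicator_iff_restrict (hU i).measurableSet,
            Measure.restrict_restrict (hU i).measurableSet,
            Set.inter_eq_self_of_subset_left (hsub i)]
          exact hvL i
        · rw [Set.inter_iUnion]
          refine (ae_restrict_iUnion_iff _ _).mpr fun j => ?_
          filter_upwards [hvu j, ae_restrict_mem (hΩ.inter (hU j).measurableSet)] with x hx hxU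
          rw [Finset.sum_indicator_apply_of_mem F U hd v hxU.2]
          split_ifs with hj
          · exact hx
          · exact (hF j hj x hxU.2).symm
    _ = ∑' j, ∫⁻ x in U j, ‖(∑ i ∈ F, (U i).indicator (g i)) x‖ₑ ^ q :=
        lintegral_iUnion (fun i => (hU i).measurableSet) hd _
    _ = ∑ j ∈ F, ∫⁻ x in U j, ‖(∑ i ∈ F, (U i).indicator (g i)) x‖ₑ ^ q := by
        refine tsum_eq_sum fun j hj => ?_
        rw [setLIntegral_congr_fun (hU j).measurableSet (g := fun _ => 0), lintegral_zero]
        intro x hx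
        simp only
        rw [Finset.sum_indicator_apply_of_mem F U hd g hx, if_neg hj, enorm_zero,
          ENNReal.zero_rpow_of_pos hq]
    _ = ∑ j ∈ F, ∫⁻ x in U j, ‖g j x‖ₑ ^ q := by
        refine Finset.sum_congr rfl fun j hj => ?_
        refine setLIntegral_congr_fun (hU j).measurableSet ?_
        intro x hx
        simp only
        rw [Finset.sum_indicator_apply_of_mem F U hd g hx, if_pos hj]
    _ ≤ ∑ j ∈ F, (extensionEnergy q Ω (U j) u + δ j) :=
        Finset.sum_le_sum fun j _ => (hge j).le
    _ = ∑ j ∈ F, extensionEnergy q Ω (U j) u + ∑ j ∈ F, (δ j : ℝ≥0∞) := Finset.sum_add_distrib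
    _ ≤ ∑ j ∈ F, extensionEnergy q Ω (U j) u + ε := by
        gcongr
        exact (ENNReal.sum_le_tsum F).trans hδs.le

/-! ### Test pairs and their Sobolev energy. -/

theorem IsTestPair.mono (h : IsTestPair p Ω U u g) (hUV : U ⊆ V) : IsTestPair p Ω V u g :=
  ⟨h.hasWeakGradient, h.memLp, h.memLp_grad, by
    obtain ⟨K, hK, hKU, h1, h2⟩ := h.exists_isCompact
    exact ⟨K, hK, hKU.trans hUV, h1, h2⟩⟩

theorem IsTestPair.smul_add_smul (h : IsTestPair p Ω U u g) (h' : IsTestPair p Ω V w k)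
    (c d : ℝ) : IsTestPair p Ω (U ∪ V) (c • u + d • w) (c • g + d • k) :=
  ⟨(h.hasWeakGradient.const_smul c).add (h'.hasWeakGradient.const_smul d),
    (h.memLp.const_smul c).add (h'.memLp.const_smul d),
    (h.memLp_grad.const_smul c).add (h'.memLp_grad.const_smul d), by
    obtain ⟨K, hK, hKU, h1, h2⟩ := h.exists_isCompact
    obtain ⟨L, hL, hLV, h3, h4⟩ := h'.exists_isCompact
    refine ⟨K ∪ L, hK.union hL, Set.union_subset_union hKU hLV, ?_, ?_⟩
    · intro x hx
      rw [Set.mem_union, not_or] at hx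
      simp [h1 x hx.1, h3 x hx.2]
    · intro x hx
      rw [Set.mem_union, not_or] at hx
      simp [h2 x hx.1, h4 x hx.2]⟩

theorem IsTestPair.aemeasurable_energy (h : IsTestPair p Ω U u g) :
    AEMeasurable (fun x => ‖u x‖ₑ ^ p + ‖g x‖ₑ ^ p) (volume.restrict Ω) :=
  (h.memLp.1.enorm.pow_const p).add (h.memLp_grad.1.enorm.pow_const p)

theorem lintegral_enorm_rpow_eq_eLpNorm_rpow {F : Type*} [NormedAddCommGroup F] {f : E → F}
    (hp : 0 < p) (μ : Measure E) :
    ∫⁻ x, ‖f x‖ₑ ^ p ∂μ = eLpNorm f (ENNReal.ofReal p) μ ^ p := by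
  have h := eLpNorm_nnreal_pow_eq_lintegral (f := f) (μ := μ) (p := p.toNNReal)
    (by simpa using hp)
  rw [Real.coe_toNNReal _ hp.le] at h
  exact h.symm

theorem IsTestPair.sobolevEnergy_eq (hp : 0 < p) (h : IsTestPair p Ω U u g) :
    sobolevEnergy p Ω u g = eLpNorm u (ENNReal.ofReal p) (volume.restrict Ω) ^ p +
      eLpNorm g (ENNReal.ofReal p) (volume.restrict Ω) ^ p := by
  rw [sobolevEnergy, lintegral_add_left' (h.memLp.1.enorm.pow_const p),
    lintegral_enorm_rpow_eq_eLpNorm_rpow hp, lintegral_enorm_rpow_eq_eLpNorm_rpow hp]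

theorem IsTestPair.sobolevEnergy_ne_top (hp : 0 < p) (h : IsTestPair p Ω U u g) :
    sobolevEnergy p Ω u g ≠ ⊤ := by
  rw [h.sobolevEnergy_eq hp]
  exact ENNReal.add_ne_top.mpr ⟨ENNReal.rpow_ne_top_of_nonneg hp.le h.memLp.2.ne,
    ENNReal.rpow_ne_top_of_nonneg hp.le h.memLp_grad.2.ne⟩

/-- Zero Sobolev energy forces u = 0 a.e. on Ω. Hence a vanishing denominator in the defining
quotient occurs only as 0/0, which is 0 in `ℝ≥0∞`. -/
theorem IsTestPair.extensionEnergy_eq_zero (hp : 0 < p) (hq : 0 < q) (h : IsTestPair p Ω U u g)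
    (h0 : sobolevEnergy p Ω u g = 0) (W : Set E) : extensionEnergy q Ω W u = 0 := by
  apply _root_.extensionEnergy_eq_zero hq
  rw [sobolevEnergy, lintegral_eq_zero_iff' h.aemeasurable_energy] at h0
  refine ae_restrict_of_ae_restrict_of_subset Set.inter_subset_left ?_
  filter_upwards [h0] with x hx
  simp only [Pi.zero_apply, add_eq_zero, ENNReal.rpow_eq_zero_iff_of_pos hp, enorm_eq_zero] at hx
  exact hx.1

theorem sobolevEnergy_smul_add_smul_le {c d : ℝ} (hc : 0 < c) (hd : 0 < d) (hp : 0 < p)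
    (hUV : Disjoint U V) (h : IsTestPair p Ω U u g) (h' : IsTestPair p Ω V w k) :
    sobolevEnergy p Ω (c • u + d • w) (c • g + d • k) ≤
      ENNReal.ofReal c ^ p * sobolevEnergy p Ω u g +
        ENNReal.ofReal d ^ p * sobolevEnergy p Ω w k := by
  have hc0 : ENNReal.ofReal c ^ p ≠ ⊤ := ENNReal.rpow_ne_top_of_nonneg hp.le ENNReal.ofReal_ne_top
  have hd0 : ENNReal.ofReal d ^ p ≠ ⊤ := ENNReal.rpow_ne_top_of_nonneg hp.le ENNReal.ofReal_ne_top
  obtain ⟨K, hK, hKU, h1, h2⟩ := h.exists_isCompact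
  obtain ⟨L, hL, hLV, h3, h4⟩ := h'.exists_isCompact
  unfold sobolevEnergy
  rw [← lintegral_const_mul' _ _ hc0, ← lintegral_const_mul' _ _ hd0,
    ← lintegral_add_left' (h.aemeasurable_energy.const_mul _)]
  refine lintegral_mono fun x => ?_
  have e : ∀ {F : Type} [NormedAddCommGroup F] [NormedSpace ℝ F] (a : F) {b : ℝ}, 0 < b →
      ‖b • a‖ₑ ^ p = ENNReal.ofReal b ^ p * ‖a‖ₑ ^ p := by
    intro F _ _ a b hb
    rw [enorm_smul, ENNReal.mul_rpow_of_nonneg _ _ hp.le, Real.enorm_of_nonneg hb.le]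
  by_cases hx : x ∈ K
  · have hxL : x ∉ L := fun hxL => Set.disjoint_left.mp hUV (hKU hx) (hLV hxL)
    simp only [Pi.add_apply, Pi.smul_apply, h3 x hxL, h4 x hxL, smul_zero, add_zero, enorm_zero,
      ENNReal.zero_rpow_of_pos hp, mul_zero]
    rw [e _ hc, e _ hc, mul_add]
  · simp only [Pi.add_apply, Pi.smul_apply, h1 x hx, h2 x hx, smul_zero, zero_add, enorm_zero,
      ENNReal.zero_rpow_of_pos hp, mul_zero]
    rw [e _ hd, e _ hd, mul_add]

theorem sobolevEnergy_indicator (hp : 0 < p) (hV : MeasurableSet V) :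
    sobolevEnergy p Ω (V.indicator u) (V.indicator g)
      = ∫⁻ x in V ∩ Ω, (‖u x‖ₑ ^ p + ‖g x‖ₑ ^ p) := by
  unfold sobolevEnergy
  rw [← Measure.restrict_restrict hV, ← lintegral_indicator hV]
  congr 1
  ext x
  by_cases hx : x ∈ V <;> simp [hx, ENNReal.zero_rpow_of_pos hp]

theorem sum_sobolevEnergy_indicator_le (hp : 0 < p) (hΩ : MeasurableSet Ω) {U : ℕ → Set E}
    (hU : ∀ i, MeasurableSet (U i)) (hd : Pairwise fun i j => Disjoint (U i) (U j))
    (F : Finset ℕ) :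
    ∑ i ∈ F, sobolevEnergy p Ω ((U i).indicator u) ((U i).indicator g)
      ≤ sobolevEnergy p Ω u g := by
  simp only [sobolevEnergy_indicator hp (hU _)]
  rw [← lintegral_biUnion_finset (fun i _ j _ hij =>
    (hd hij).mono Set.inter_subset_left Set.inter_subset_left) fun i _ => (hU i).inter hΩ]
  exact lintegral_mono_set (Set.iUnion₂_subset fun i _ => Set.inter_subset_right)

/-! ### The set function: monotonicity and countable additivity. -/

theorem div_rpow_rpow_le_iff (hq : 0 < q) (hqp : q < p) {a b t : ℝ≥0∞} (hb : b ≠ ⊤)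
    (hab : b = 0 → a = 0) :
    (a / b ^ (q / p)) ^ (p / (p - q)) ≤ t ↔ a ≤ t ^ ((p - q) / p) * b ^ (q / p) := by
  have hp : 0 < p := hq.trans hqp
  have hpq : 0 < p - q := sub_pos.mpr hqp
  have hθ : 0 < q / p := div_pos hq hp
  rw [← inv_div (p - q) p, ENNReal.rpow_inv_le_iff (div_pos hpq hp)]
  by_cases h0 : b = 0
  · simp [h0, hab h0]
  · rw [ENNReal.div_le_iff (by simp [h0, hb])
      (ENNReal.rpow_ne_top_of_nonneg hθ.le hb)]

theorem le_extensionSetFunction (h : IsTestPair p Ω U u g) :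
    (extensionEnergy q Ω U u / sobolevEnergy p Ω u g ^ (q / p)) ^ (p / (p - q))
      ≤ extensionSetFunction p q Ω U :=
  le_iSup_of_le u (le_iSup_of_le g (le_iSup_of_le h le_rfl))

theorem extensionEnergy_le_extensionSetFunction (hq : 0 < q) (hqp : q < p)
    (h : IsTestPair p Ω U u g) :
    extensionEnergy q Ω U u ≤
      extensionSetFunction p q Ω U ^ ((p - q) / p) * sobolevEnergy p Ω u g ^ (q / p) :=
  (div_rpow_rpow_le_iff hq hqp (h.sobolevEnergy_ne_top (hq.trans hqp))
    fun h0 => h.extensionEnergy_eq_zero (hq.trans hqp) hq h0 U).mp (le_extensionSetFunction h)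

theorem extensionSetFunction_le (hq : 0 < q) (hqp : q < p) {t : ℝ≥0∞}
    (h : ∀ u g, IsTestPair p Ω U u g →
      extensionEnergy q Ω U u ≤ t ^ ((p - q) / p) * sobolevEnergy p Ω u g ^ (q / p)) :
    extensionSetFunction p q Ω U ≤ t :=
  iSup_le fun u => iSup_le fun g => iSup_le fun hu =>
    (div_rpow_rpow_le_iff hq hqp (hu.sobolevEnergy_ne_top (hq.trans hqp))
      fun h0 => hu.extensionEnergy_eq_zero (hq.trans hqp) hq h0 U).mpr (h u g hu)

theorem extensionSetFunction_mono (hq : 0 < q) (hqp : q < p) (hV : MeasurableSet V)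
    (hUV : U ⊆ V) : extensionSetFunction p q Ω U ≤ extensionSetFunction p q Ω V :=
  extensionSetFunction_le hq hqp fun _ _ h => (extensionEnergy_mono hV hUV).trans
    (extensionEnergy_le_extensionSetFunction hq hqp (h.mono hUV))

/-- The scale is c = (a/b)^{1/(p-q)}. It makes the q-homogeneous and the p-homogeneous energy equal
to each other and to the normalised quotient, the balance at which Hölder's inequality loses
nothing. -/
theorem exists_rpow_mul_eq (hqp : q < p) {a b : ℝ≥0∞} (ha : a ≠ 0) (ha' : a ≠ ⊤) (hb : b ≠ 0)
    (hb' : b ≠ ⊤) (hp : 0 < p) :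
    ∃ c : ℝ, 0 < c ∧ ENNReal.ofReal c ^ q * a = (a / b ^ (q / p)) ^ (p / (p - q)) ∧
      ENNReal.ofReal c ^ p * b = (a / b ^ (q / p)) ^ (p / (p - q)) := by
  have hex : ∀ t : ℝ≥0∞, t ≠ 0 → t ≠ ⊤ → ∃ x : ℝ, t = ENNReal.ofReal (Real.exp x) := by
    intro t h0 h1
    refine ⟨Real.log t.toReal, ?_⟩
    rw [Real.exp_log (ENNReal.toReal_pos h0 h1), ENNReal.ofReal_toReal h1]
  obtain ⟨x, rfl⟩ := hex a ha ha'
  obtain ⟨y, rfl⟩ := hex b hb hb'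
  have hpq : p - q ≠ 0 := (sub_pos.mpr hqp).ne'
  have hr : ∀ s t : ℝ, ENNReal.ofReal (Real.exp s) ^ t = ENNReal.ofReal (Real.exp (s * t)) := by
    intro s t
    rw [ENNReal.ofReal_rpow_of_pos (Real.exp_pos s), Real.exp_mul]
  refine ⟨Real.exp ((x - y) / (p - q)), Real.exp_pos _, ?_, ?_⟩
  · rw [hr, hr, ← ENNReal.ofReal_div_of_pos (Real.exp_pos _), ← Real.exp_sub, hr,
      ← ENNReal.ofReal_mul (Real.exp_pos _).le, ← Real.exp_add]
    congr 2
    field_simp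
    ring
  · rw [hr, hr, ← ENNReal.ofReal_div_of_pos (Real.exp_pos _), ← Real.exp_sub, hr,
      ← ENNReal.ofReal_mul (Real.exp_pos _).le, ← Real.exp_add]
    congr 2
    field_simp
    ring

theorem extensionSetFunction_add_le (hq : 0 < q) (hqp : q < p) (hΩ : MeasurableSet Ω)
    (hU : IsOpen U) (hV : IsOpen V) (hUV : Disjoint U V) :
    extensionSetFunction p q Ω U + extensionSetFunction p q Ω V
      ≤ extensionSetFunction p q Ω (U ∪ V) := by
  have hp : 0 < p := hq.trans hqp
  have hpq : 0 < p - q := sub_pos.mpr hqp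
  have hm := hU.measurableSet.union hV.measurableSet
  set T := extensionSetFunction p q Ω (U ∪ V) with hT
  have hUT : extensionSetFunction p q Ω U ≤ T :=
    extensionSetFunction_mono hq hqp hm Set.subset_union_left
  have hVT : extensionSetFunction p q Ω V ≤ T :=
    extensionSetFunction_mono hq hqp hm Set.subset_union_right
  by_cases hTtop : T = ⊤
  · rw [hTtop]; exact le_top
  have hfin : ∀ {W : Set E} {f : E → ℝ} {k : E → E}, IsTestPair p Ω W f k →
      extensionSetFunction p q Ω W ≤ T → extensionEnergy q Ω W f ≠ ⊤ := by
    intro W f k hf hW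
    refine ne_top_of_le_ne_top ?_ (extensionEnergy_le_extensionSetFunction hq hqp hf)
    exact ENNReal.mul_ne_top (ENNReal.rpow_ne_top_of_nonneg (div_pos hpq hp).le
      (ne_top_of_le_ne_top hTtop hW)) (ENNReal.rpow_ne_top_of_nonneg (div_pos hq hp).le
      (hf.sobolevEnergy_ne_top hp))
  have hzero : ∀ b : ℝ≥0∞, ((0 : ℝ≥0∞) / b) ^ (p / (p - q)) = 0 := by
    intro b
    rw [ENNReal.zero_div, ENNReal.zero_rpow_of_pos (div_pos hp hpq)]
  have main : ∀ u g w k, IsTestPair p Ω U u g → IsTestPair p Ω V w k →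
      (extensionEnergy q Ω U u / sobolevEnergy p Ω u g ^ (q / p)) ^ (p / (p - q)) +
      (extensionEnergy q Ω V w / sobolevEnergy p Ω w k ^ (q / p)) ^ (p / (p - q)) ≤ T := by
    intro u g w k h h'
    by_cases hu0 : extensionEnergy q Ω U u = 0
    · rw [hu0, hzero, zero_add]
      exact (le_extensionSetFunction h').trans hVT
    by_cases hw0 : extensionEnergy q Ω V w = 0
    · rw [hw0, hzero, add_zero]
      exact (le_extensionSetFunction h).trans hUT
    obtain ⟨c, hc, hc1, hc2⟩ := exists_rpow_mul_eq hqp hu0 (hfin h hUT)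
      (fun h0 => hu0 (h.extensionEnergy_eq_zero hp hq h0 U)) (h.sobolevEnergy_ne_top hp) hp
    obtain ⟨d, hd, hd1, hd2⟩ := exists_rpow_mul_eq hqp hw0 (hfin h' hVT)
      (fun h0 => hw0 (h'.extensionEnergy_eq_zero hp hq h0 V)) (h'.sobolevEnergy_ne_top hp) hp
    set s := (extensionEnergy q Ω U u / sobolevEnergy p Ω u g ^ (q / p)) ^ (p / (p - q)) with hs
    set t := (extensionEnergy q Ω V w / sobolevEnergy p Ω w k ^ (q / p)) ^ (p / (p - q)) with ht
    have hsT : s ≤ T := (le_extensionSetFunction h).trans hUT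
    have htT : t ≤ T := (le_extensionSetFunction h').trans hVT
    have hst : s + t ≠ ⊤ :=
      ENNReal.add_ne_top.mpr ⟨ne_top_of_le_ne_top hTtop hsT, ne_top_of_le_ne_top hTtop htT⟩
    obtain ⟨K, -, hKU, h1, -⟩ := h.exists_isCompact
    obtain ⟨L, -, hLV, h3, -⟩ := h'.exists_isCompact
    -- After rescaling, s + t is a lower bound for the extension energy of the combined function and
    -- an upper bound for its Sobolev energy.
    have key : s + t ≤ T ^ ((p - q) / p) * (s + t) ^ (q / p) := by
      calc s + t = ENNReal.ofReal c ^ q * extensionEnergy q Ω U u +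
            ENNReal.ofReal d ^ q * extensionEnergy q Ω V w := by rw [hc1, hd1]
        _ ≤ extensionEnergy q Ω (U ∪ V) (c • u + d • w) :=
            extensionEnergy_add_le hc hd hq.le hΩ hU hV hUV
              (fun x hx => h1 x fun hxK => Set.disjoint_left.mp hUV (hKU hxK) hx)
              (fun x hx => h3 x fun hxL => Set.disjoint_left.mp hUV hx (hLV hxL))
        _ ≤ T ^ ((p - q) / p) *
            sobolevEnergy p Ω (c • u + d • w) (c • g + d • k) ^ (q / p) :=
            extensionEnergy_le_extensionSetFunction hq hqp (h.smul_add_smul h' c d)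
        _ ≤ T ^ ((p - q) / p) * (s + t) ^ (q / p) := by
            gcongr
            refine (sobolevEnergy_smul_add_smul_le hc hd hp hUV h h').trans_eq ?_
            rw [hc2, hd2]
    -- With both energies replaced by s + t, the normalised quotient is s + t itself, so `key` says
    -- s + t ≤ T.
    refine le_trans (le_of_eq ?_)
      ((div_rpow_rpow_le_iff hq hqp (t := T) hst id).mpr key)
    by_cases h0 : s + t = 0
    · rw [h0, hzero]
    · have e1 : (s + t) / (s + t) ^ (q / p) = (s + t) ^ ((p - q) / p) := by
        nth_rewrite 1 [← ENNReal.rpow_one (s + t)]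
        rw [← ENNReal.rpow_sub _ _ h0 hst]
        congr 1
        field_simp
      rw [e1, ← ENNReal.rpow_mul]
      have : (p - q) / p * (p / (p - q)) = 1 := by field_simp
      rw [this, ENNReal.rpow_one]
  have hVtop := ne_top_of_le_ne_top hTtop hVT
  -- The bound for pairs passes to the two suprema one at a time, by subtracting from T; finiteness
  -- makes the subtraction reversible.
  refine (add_le_add_left ?_ _).trans_eq (tsub_add_cancel_of_le hVT)
  refine iSup_le fun u => iSup_le fun g => iSup_le fun h => ?_
  refine ENNReal.le_sub_of_add_le_right hVtop ?_
  have hs := (le_extensionSetFunction h).trans hUT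
  refine (add_le_add_right ?_ _).trans_eq (add_tsub_cancel_of_le hs)
  refine iSup_le fun w => iSup_le fun k => iSup_le fun h' => ?_
  exact ENNReal.le_sub_of_add_le_left (ne_top_of_le_ne_top hTtop hs) (main u g w k h h')

/-- The part of the support in one piece is K minus the other open pieces, hence again compact. -/
theorem IsTestPair.indicator {U : ℕ → Set E}
    (hU : ∀ i, IsOpen (U i)) (hd : Pairwise fun i j => Disjoint (U i) (U j))
    (h : IsTestPair p Ω (⋃ i, U i) u g) (i : ℕ) :
    IsTestPair p Ω (U i) ((U i).indicator u) ((U i).indicator g) := by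
  obtain ⟨K, hK, hKU, h1, h2⟩ := h.exists_isCompact
  have e : K ∩ U i = K \ ⋃ j, ⋃ (_ : j ≠ i), U j := by
    ext x
    simp only [Set.mem_inter_iff, Set.mem_sdiff, Set.mem_iUnion, exists_prop, not_exists, not_and]
    constructor
    · rintro ⟨hx, hxi⟩
      exact ⟨hx, fun j hj hxj => Set.disjoint_left.mp (hd hj) hxj hxi⟩
    · rintro ⟨hx, hxj⟩
      obtain ⟨j, hj⟩ := Set.mem_iUnion.mp (hKU hx)
      by_cases hji : j = i
      · exact ⟨hx, hji ▸ hj⟩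
      · exact absurd hj (hxj j hji)
  have hc : IsCompact (K ∩ U i) := by
    rw [e]; exact hK.diff (isOpen_iUnion fun j => isOpen_iUnion fun _ => hU j)
  refine ⟨h.hasWeakGradient.indicator_of_isCompact (hU i) hK hc.isClosed h1 h2,
    h.memLp.indicator (hU i).measurableSet, h.memLp_grad.indicator (hU i).measurableSet,
    K ∩ U i, hc, Set.inter_subset_right, ?_, ?_⟩
  · intro x hx
    by_cases hxU : x ∈ U i
    · rw [Set.indicator_of_mem hxU, h1 x fun hxK => hx ⟨hxK, hxU⟩]
    · rw [Set.indicator_of_notMem hxU]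
  · intro x hx
    by_cases hxU : x ∈ U i
    · rw [Set.indicator_of_mem hxU, h2 x fun hxK => hx ⟨hxK, hxU⟩]
    · rw [Set.indicator_of_notMem hxU]

theorem extensionSetFunction_iUnion_le (hq : 0 < q) (hqp : q < p) (hΩ : MeasurableSet Ω)
    {U : ℕ → Set E} (hU : ∀ i, IsOpen (U i)) (hd : Pairwise fun i j => Disjoint (U i) (U j)) :
    extensionSetFunction p q Ω (⋃ i, U i) ≤ ∑' i, extensionSetFunction p q Ω (U i) := by
  have hp : 0 < p := hq.trans hqp
  have hpq : 0 < p - q := sub_pos.mpr hqp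
  refine extensionSetFunction_le hq hqp fun u g h => ?_
  obtain ⟨K, hK, hKU, h1, h2⟩ := h.exists_isCompact
  obtain ⟨F, hF⟩ := hK.elim_finite_subcover U hU hKU
  have hF' : ∀ i ∉ F, ∀ x ∈ U i, u x = 0 := by
    intro i hi x hx
    refine h1 x fun hxK => ?_
    obtain ⟨j, hj, hxj⟩ := Set.mem_iUnion₂.mp (hF hxK)
    have hij : i ≠ j := fun hij => hi (hij ▸ hj)
    exact Set.disjoint_left.mp (hd hij) hx hxj
  -- Conjugate because (p-q)/p + q/p = 1; these are the exponents on the set function and on the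
  -- Sobolev energy.
  have hconj : (p / (p - q)).HolderConjugate (p / q) := by
    rw [Real.holderConjugate_iff]
    constructor
    · rw [lt_div_iff₀ hpq]; linarith
    · field_simp; ring
  calc extensionEnergy q Ω (⋃ i, U i) u
      ≤ ∑ i ∈ F, extensionEnergy q Ω (U i) u := extensionEnergy_iUnion_le hq hΩ hU hd F hF'
    _ ≤ ∑ i ∈ F, extensionSetFunction p q Ω (U i) ^ ((p - q) / p) *
          sobolevEnergy p Ω ((U i).indicator u) ((U i).indicator g) ^ (q / p) := by
        refine Finset.sum_le_sum fun i _ => ?_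
        refine le_trans (extensionEnergy_congr_le hΩ (hU i).measurableSet
          (v := (U i).indicator u) fun x hx => (Set.indicator_of_mem hx u).symm) ?_
        exact extensionEnergy_le_extensionSetFunction hq hqp (h.indicator hU hd i)
    _ ≤ (∑ i ∈ F, extensionSetFunction p q Ω (U i)) ^ ((p - q) / p) *
          (∑ i ∈ F, sobolevEnergy p Ω ((U i).indicator u) ((U i).indicator g)) ^ (q / p) := by
        refine (ENNReal.inner_le_Lp_mul_Lq F _ _ hconj).trans_eq ?_
        have e1 : (p - q) / p * (p / (p - q)) = 1 := by field_simp
        have e2 : q / p * (p / q) = 1 := by field_simp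
        simp only [← ENNReal.rpow_mul, e1, e2, ENNReal.rpow_one, one_div, inv_div]
    _ ≤ (∑' i, extensionSetFunction p q Ω (U i)) ^ ((p - q) / p) *
          sobolevEnergy p Ω u g ^ (q / p) := by
        have h1 : 0 ≤ (p - q) / p := (div_pos hpq hp).le
        gcongr
        · exact ENNReal.sum_le_tsum F
        · exact sum_sobolevEnergy_indicator_le hp hΩ (fun i => (hU i).measurableSet) hd F

theorem sum_extensionSetFunction_le (hq : 0 < q) (hqp : q < p) (hΩ : MeasurableSet Ω)
    {U : ℕ → Set E} (hU : ∀ i, IsOpen (U i)) (hd : Pairwise fun i j => Disjoint (U i) (U j))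
    (F : Finset ℕ) :
    ∑ i ∈ F, extensionSetFunction p q Ω (U i) ≤ extensionSetFunction p q Ω (⋃ i ∈ F, U i) := by
  classical
  induction F using Finset.induction_on with
  | empty => simp
  | insert a F ha ih =>
    rw [Finset.sum_insert ha, Finset.set_biUnion_insert]
    refine (add_le_add le_rfl ih).trans (extensionSetFunction_add_le hq hqp hΩ (hU a)
      (isOpen_biUnion fun i _ => hU i) ?_)
    rw [Set.disjoint_iUnion₂_right]
    intro i hi
    exact hd (by rintro rfl; exact ha hi)

theorem extensionSetFunction_iUnion (hq : 0 < q) (hqp : q < p) (hΩ : MeasurableSet Ω)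
    {U : ℕ → Set E} (hU : ∀ i, IsOpen (U i)) (hd : Pairwise fun i j => Disjoint (U i) (U j)) :
    extensionSetFunction p q Ω (⋃ i, U i) = ∑' i, extensionSetFunction p q Ω (U i) := by
  refine le_antisymm (extensionSetFunction_iUnion_le hq hqp hΩ hU hd) ?_
  rw [ENNReal.tsum_eq_iSup_sum]
  refine iSup_le fun F => (sum_extensionSetFunction_le hq hqp hΩ hU hd F).trans ?_
  exact extensionSetFunction_mono hq hqp (MeasurableSet.iUnion fun i => (hU i).measurableSet)
    (Set.iUnion₂_subset fun i _ => Set.subset_iUnion U i)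

end SetFunction

/-! ### Boundedness from the extension operator. -/

section Capacity

variable {n : ℕ}

local notation "E" => EuclideanSpace ℝ (Fin n)

theorem IsTestPair.weakGradient_ae_eq {p : ℝ} {Ω U : Set E} {u : E → ℝ} {g : E → E}
    (h : IsTestPair p Ω U u g) (hΩ : IsOpen Ω) :
    weakGradient Ω u =ᵐ[volume.restrict Ω] g := h.hasWeakGradient.weakGradient_ae_eq hΩ

theorem IsTestPair.memW1 {p : ℝ} {Ω U : Set E} {u : E → ℝ} {g : E → E}
    (h : IsTestPair p Ω U u g) (hΩ : IsOpen Ω) : MemW1 p Ω u :=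
  ⟨h.memLp, ⟨g, h.hasWeakGradient⟩, h.memLp_grad.ae_eq (h.weakGradient_ae_eq hΩ).symm⟩

theorem IsTestPair.normW1_eq {p : ℝ} {Ω U : Set E} {u : E → ℝ} {g : E → E}
    (h : IsTestPair p Ω U u g) (hΩ : IsOpen Ω) :
    normW1 p Ω u = eLpNorm u (ENNReal.ofReal p) (volume.restrict Ω) +
      eLpNorm g (ENNReal.ofReal p) (volume.restrict Ω) := by
  rw [normW1, eLpNorm_congr_ae (h.weakGradient_ae_eq hΩ)]

theorem IsTestPair.normW1_le {p : ℝ} {Ω U : Set E} {u : E → ℝ} {g : E → E} (hp : 0 < p)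
    (h : IsTestPair p Ω U u g) (hΩ : IsOpen Ω) :
    normW1 p Ω u ≤ 2 * sobolevEnergy p Ω u g ^ p⁻¹ := by
  rw [h.normW1_eq hΩ, two_mul, h.sobolevEnergy_eq hp]
  exact add_le_add ((ENNReal.le_rpow_inv_iff hp).mpr le_self_add)
    ((ENNReal.le_rpow_inv_iff hp).mpr le_add_self)

theorem IsBoundedExtensionOperator.exists_extensionEnergy_le {p q : ℝ} {Ω : Set E}
    {T : (E → ℝ) → (E → ℝ)} (hT : IsBoundedExtensionOperator p q Ω T) (hp : 0 < p) (hq : 0 < q)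
    (hΩ : IsOpen Ω) :
    ∃ M : ℝ≥0, ∀ (U : Set E) (u : E → ℝ) (g : E → E), IsTestPair p Ω U u g →
      extensionEnergy q Ω U u ≤ M * sobolevEnergy p Ω u g ^ (q / p) := by
  obtain ⟨C, hC⟩ := hT.bounded
  -- The 2 comes from bounding each of the two terms of the norm by S(u)^{1/p}.
  refine ⟨(C * 2) ^ q, fun U u g h => ?_⟩
  -- The operator bound is assumed only for nonzero norm; at norm zero the extension energy
  -- vanishes.
  by_cases h0 : normW1 p Ω u = 0
  · rw [h.extensionEnergy_eq_zero hp hq ?_ U]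
    · exact zero_le
    · rw [h.normW1_eq hΩ, add_eq_zero] at h0
      rw [h.sobolevEnergy_eq hp, h0.1, h0.2, ENNReal.zero_rpow_of_pos hp, add_zero]
  have hu := h.memW1 hΩ
  have hTu := hT.mem u hu
  have hL : MemLp (T u) (ENNReal.ofReal q) (volume.restrict Set.univ) := hTu.memLp
  calc extensionEnergy q Ω U u
      ≤ extensionEnergy q Ω Set.univ u := extensionEnergy_mono MeasurableSet.univ (Set.subset_univ U)
    _ ≤ ∫⁻ x in Set.univ, ‖weakGradient Set.univ (T u) x‖ₑ ^ q := by
        refine extensionEnergy_le (hasWeakGradient_weakGradient hTu.exists_weakGradient) hL ?_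
        rw [Set.inter_univ]
        exact hT.extends_self u hu
    _ = eLpNorm (weakGradient Set.univ (T u)) (ENNReal.ofReal q) (volume.restrict Set.univ) ^ q :=
        lintegral_enorm_rpow_eq_eLpNorm_rpow hq _
    _ ≤ (C * (2 * sobolevEnergy p Ω u g ^ p⁻¹)) ^ q := by
        gcongr
        exact le_add_self.trans ((hC u hu h0).trans (by gcongr; exact h.normW1_le hp hΩ))
    _ = ((C * 2) ^ q : ℝ≥0) * sobolevEnergy p Ω u g ^ (q / p) := by
        rw [← mul_assoc, ENNReal.mul_rpow_of_nonneg _ _ hq.le, ← ENNReal.rpow_mul,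
          ENNReal.coe_rpow_of_nonneg _ hq.le, inv_mul_eq_div]
        simp

theorem exists_extensionSetFunction_le {p q : ℝ} {Ω : Set E} (hq : 0 < q) (hqp : q < p)
    (hΩ : IsSobolevExtensionDomain p q Ω) :
    ∃ M : ℝ≥0, ∀ U : Set E, extensionSetFunction p q Ω U ≤ M := by
  have hp : 0 < p := hq.trans hqp
  have hpq : 0 < p - q := sub_pos.mpr hqp
  obtain ⟨T, hT⟩ := hΩ.exists_extension
  obtain ⟨M, hM⟩ := hT.exists_extensionEnergy_le hp hq hΩ.isOpen
  refine ⟨M ^ (p / (p - q)), fun U => extensionSetFunction_le hq hqp fun u g h => ?_⟩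
  have e : p / (p - q) * ((p - q) / p) = 1 := by field_simp
  rw [ENNReal.coe_rpow_of_nonneg _ (div_pos hp hpq).le, ← ENNReal.rpow_mul, e, ENNReal.rpow_one]
  exact hM U u g h

/-! ### The capacity estimate by testing with cutoffs. -/

theorem variationalCapacity_le_extensionEnergy {q : ℝ} {Ω : Set E} (hq : 0 < q) (hΩ : IsOpen Ω)
    {x : E} {r : ℝ} (hr : 0 < r) {u : E → ℝ} (h1 : ∀ y ∈ Metric.ball x (r / 4), u y = 1)
    (h0 : ∀ y ∉ Metric.closedBall x (3 * r / 8), u y = 0) :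
    variationalCapacity q (Ω ∩ Metric.ball x (r / 4)) (Ω ∩ annulus x (r / 2) (3 * r / 4))
      (Metric.ball x r) ≤ extensionEnergy q Ω (Metric.ball x r) u := by
  classical
  refine le_extensionEnergy fun v g hvg hv hvu => ?_
  by_cases htop : ∫⁻ y in Metric.ball x r, ‖g y‖ₑ ^ q = ⊤
  · rw [htop]; exact le_top
  set P := Ω ∩ Metric.ball x (r / 4) with hP
  set Q := Ω ∩ (Metric.closedBall x (3 * r / 8))ᶜ with hQ
  have hPo : IsOpen P := hΩ.inter Metric.isOpen_ball
  have hQo : IsOpen Q := hΩ.inter Metric.isClosed_closedBall.isOpen_compl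
  have hPQ : ∀ y ∈ Q, y ∉ P := by
    intro y hy hy'
    apply hy.2
    rw [Metric.mem_closedBall]
    have := Metric.mem_ball.mp hy'.2
    linarith
  have hFQ : Ω ∩ annulus x (r / 2) (3 * r / 4) ⊆ Q := by
    intro y hy
    refine ⟨hy.1, fun hy' => hy.2.2 ?_⟩
    rw [Metric.mem_ball]
    have := Metric.mem_closedBall.mp hy'
    linarith
  -- An extension agrees with u only a.e. on Ω. Resetting it on a null set to be exactly 1 on the
  -- open set P and 0 on the open set Q, which contains the annular plate since 3r/8 < r/2, gives
  -- the pointwise continuity that admissibility demands.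
  set f : E → ℝ := fun y => if y ∈ P then 1 else if y ∈ Q then 0 else v y with hf
  have hfP : ∀ y ∈ P, f y = 1 := fun y hy => if_pos hy
  have hfQ : ∀ y ∈ Q, f y = 0 := fun y hy => by simp only [hf, if_neg (hPQ y hy), if_pos hy]
  have hfv : v =ᵐ[volume.restrict (Metric.ball x r)] f := by
    have h2 : ∀ᵐ y ∂volume.restrict (Metric.ball x r), y ∈ Ω → v y = u y := by
      rw [Filter.EventuallyEq, ← Measure.restrict_restrict hΩ.measurableSet,
        ae_restrict_iff' hΩ.measurableSet] at hvu
      exact hvu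
    filter_upwards [h2] with y hy
    by_cases hyP : y ∈ P
    · rw [hfP y hyP, hy hyP.1, h1 y hyP.2]
    by_cases hyQ : y ∈ Q
    · rw [hfQ y hyQ, hy hyQ.1, h0 y hyQ.2]
    simp only [hf, if_neg hyP, if_neg hyQ]
  have hfg := hvg.congr hfv
  have hwg := hfg.weakGradient_ae_eq Metric.isOpen_ball
  have hgL : MemLp g (ENNReal.ofReal q) (volume.restrict (Metric.ball x r)) := by
    refine ⟨hvg.locallyIntegrable_grad.aestronglyMeasurable, ?_⟩
    rw [lintegral_enorm_rpow_eq_eLpNorm_rpow hq] at htop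
    rw [lt_top_iff_ne_top]
    intro h
    exact htop (by rw [h, ENNReal.top_rpow_of_pos hq])
  have hadm : IsAdmissible q P (Ω ∩ annulus x (r / 2) (3 * r / 4)) (Metric.ball x r) f := by
    refine ⟨⟨hv.ae_eq hfv, ⟨g, hfg⟩, hgL.ae_eq hwg.symm⟩, ?_, fun y hy => (hfP y hy).ge,
      fun y hy => (hfQ y (hFQ hy)).le⟩
    rintro y (hy | hy)
    · refine (ContinuousAt.congr (continuousAt_const (y := (1 : ℝ))) ?_).continuousWithinAt
      filter_upwards [hPo.mem_nhds hy] with z hz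
      exact (hfP z hz).symm
    · refine (ContinuousAt.congr (continuousAt_const (y := (0 : ℝ))) ?_).continuousWithinAt
      filter_upwards [hQo.mem_nhds (hFQ hy)] with z hz
      exact (hfQ z hz).symm
  refine (iInf₂_le f hadm).trans_eq ?_
  apply lintegral_congr_ae
  filter_upwards [hwg] with y hy
  rw [hy]

/-- Translates and dilates of one fixed bump, so that L does not depend on the ball. -/
theorem exists_contDiff_cutoff (n : ℕ) :
    ∃ L : ℝ≥0, ∀ (x : EuclideanSpace ℝ (Fin n)) (r : ℝ), 0 < r →
      ∃ u : EuclideanSpace ℝ (Fin n) → ℝ, ContDiff ℝ ∞ u ∧ (∀ y, ‖u y‖ ≤ 1) ∧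
        LipschitzWith (L / r.toNNReal) u ∧ (∀ y ∈ Metric.ball x (r / 4), u y = 1) ∧
        ∀ y ∉ Metric.closedBall x (3 * r / 8), u y = 0 := by
  let ψ : ContDiffBump (0 : EuclideanSpace ℝ (Fin n)) := ⟨1 / 4, 3 / 8, by norm_num, by norm_num⟩
  have hψ : ContDiff ℝ ∞ ψ := ψ.contDiff
  obtain ⟨L, hL⟩ := hψ.lipschitzWith_of_hasCompactSupport ψ.hasCompactSupport (by simp)
  refine ⟨L, fun x r hr => ⟨fun y => ψ (r⁻¹ • (y - x)), ?_, ?_, ?_, ?_, ?_⟩⟩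
  · exact hψ.comp ((contDiff_id.sub contDiff_const).const_smul r⁻¹)
  · intro y
    rw [Real.norm_of_nonneg ψ.nonneg]
    exact ψ.le_one
  · refine LipschitzWith.of_dist_le_mul fun y z => ?_
    refine (hL.dist_le_mul _ _).trans_eq ?_
    rw [dist_smul₀, dist_sub_right, Real.norm_of_nonneg (inv_pos.mpr hr).le]
    push_cast
    rw [Real.coe_toNNReal _ hr.le]
    ring
  · intro y hy
    apply ψ.one_of_mem_closedBall
    rw [mem_closedBall_zero_iff, norm_smul, Real.norm_of_nonneg (inv_pos.mpr hr).le]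
    rw [mem_ball_iff_norm] at hy
    rw [inv_mul_le_iff₀ hr]
    change _ ≤ r * (1 / 4)
    linarith
  · intro y hy
    apply ψ.zero_of_le_dist
    rw [mem_closedBall_iff_norm, not_le] at hy
    rw [dist_zero_right, norm_smul, Real.norm_of_nonneg (inv_pos.mpr hr).le,
      le_inv_mul_iff₀ hr]
    change r * (3 / 8) ≤ _
    linarith

/-- The test pair given by a Lipschitz cutoff function of a ball. -/
theorem isTestPair_gradient {p : ℝ} (Ω : Set E) {K U : Set E} {u : E → ℝ}
    (hu : ContDiff ℝ ∞ u) (hK : IsCompact K) (hKU : K ⊆ U) (h0 : ∀ y ∉ K, u y = 0) :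
    IsTestPair p Ω U u (gradient u) := by
  have hcu : HasCompactSupport u := HasCompactSupport.intro hK h0
  have hg0 : ∀ y ∉ K, gradient u y = 0 := by
    intro y hy
    have : u =ᶠ[nhds y] fun _ => 0 := by
      filter_upwards [hK.isClosed.isOpen_compl.mem_nhds hy] with z hz
      exact h0 z hz
    simp [gradient, this.fderiv_eq]
  have hgc : Continuous (gradient u) :=
    (InnerProductSpace.toDual ℝ E).symm.continuous.comp (hu.continuous_fderiv (by simp))
  exact ⟨hasWeakGradient_gradient Ω hu hcu, (hu.continuous.memLp_of_hasCompactSupport hcu).restrict _,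
    (hgc.memLp_of_hasCompactSupport (HasCompactSupport.intro hK hg0)).restrict _,
    K, hK, hKU, h0, hg0⟩

theorem IsTestPair.sobolevEnergy_le {p : ℝ} {Ω U : Set E} {u : E → ℝ} {g : E → E} (hp : 0 < p)
    (hU : MeasurableSet U) (h : IsTestPair p Ω U u g) {a b : ℝ≥0∞} (ha : ∀ y, ‖u y‖ₑ ≤ a)
    (hb : ∀ y, ‖g y‖ₑ ≤ b) :
    sobolevEnergy p Ω u g ≤ (a ^ p + b ^ p) * volume (U ∩ Ω) := by
  obtain ⟨K, -, hKU, h1, h2⟩ := h.exists_isCompact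
  calc sobolevEnergy p Ω u g ≤ ∫⁻ y in Ω, U.indicator (fun _ => a ^ p + b ^ p) y := by
        refine lintegral_mono fun y => ?_
        by_cases hy : y ∈ U
        · rw [Set.indicator_of_mem hy]
          exact add_le_add (ENNReal.rpow_le_rpow (ha y) hp.le) (ENNReal.rpow_le_rpow (hb y) hp.le)
        · simp [h1 y fun hyK => hy (hKU hyK), h2 y fun hyK => hy (hKU hyK),
            ENNReal.zero_rpow_of_pos hp]
    _ = (a ^ p + b ^ p) * volume (U ∩ Ω) := by
        rw [lintegral_indicator_const hU, Measure.restrict_apply hU]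

theorem exists_extensionSetFunction_capacity_estimate (n : ℕ) {p q : ℝ} (hq : 0 < q)
    (hqp : q < p) :
    ∃ C : ℝ≥0, ∀ Ω : Set (EuclideanSpace ℝ (Fin n)), IsOpen Ω →
      ∀ (x : EuclideanSpace ℝ (Fin n)) (r : ℝ), 0 < r → r < 1 →
        ENNReal.ofReal (r ^ (p * q)) *
            variationalCapacity q (Ω ∩ Metric.ball x (r / 4))
              (Ω ∩ annulus x (r / 2) (3 * r / 4)) (Metric.ball x r) ^ p
          ≤ extensionSetFunction p q Ω (Metric.ball x r) ^ (p - q) *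
            (C * volume (Metric.ball x r ∩ Ω)) ^ q := by
  have hp : 0 < p := hq.trans hqp
  obtain ⟨L, hL⟩ := exists_contDiff_cutoff n
  -- From r^p (1 + (L/r)^p) = r^p + L^p and r < 1.
  refine ⟨1 + L ^ p, fun Ω hΩ x r hr hr1 => ?_⟩
  obtain ⟨u, hu, hu1, huL, h1, h0⟩ := hL x r hr
  have hsub : Metric.closedBall x (3 * r / 8) ⊆ Metric.ball x r :=
    Metric.closedBall_subset_ball (by linarith)
  have ht : IsTestPair p Ω (Metric.ball x r) u (gradient u) :=
    isTestPair_gradient Ω hu (isCompact_closedBall x _) hsub h0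
  have hN : ENNReal.ofReal r ^ p * sobolevEnergy p Ω u (gradient u) ≤
      ((1 + L ^ p : ℝ≥0) : ℝ≥0∞) * volume (Metric.ball x r ∩ Ω) := by
    have hr0 : r.toNNReal ≠ 0 := by simpa using hr
    have e := ht.sobolevEnergy_le hp Metric.isOpen_ball.measurableSet (a := 1)
      (b := (L / r.toNNReal : ℝ≥0)) (fun y => by
        rw [← ofReal_norm]; exact ENNReal.ofReal_le_one.mpr (hu1 y)) (fun y => by
        rw [← ofReal_norm, gradient, LinearIsometryEquiv.norm_map]
        refine (ENNReal.ofReal_le_ofReal (norm_fderiv_le_of_lipschitz ℝ huL)).trans_eq ?_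
        rw [ENNReal.ofReal_coe_nnreal])
    refine (mul_le_mul_right e _).trans ?_
    rw [← mul_assoc]
    gcongr
    rw [mul_add, ENNReal.one_rpow, mul_one, ← ENNReal.mul_rpow_of_nonneg _ _ hp.le]
    have e2 : ENNReal.ofReal r * ((L / r.toNNReal : ℝ≥0) : ℝ≥0∞) = L := by
      rw [ENNReal.ofReal, ← ENNReal.coe_mul, mul_div_cancel₀ _ hr0]
    rw [e2, ENNReal.coe_add, ENNReal.coe_one, ENNReal.coe_rpow_of_nonneg _ hp.le]
    gcongr
    exact ENNReal.rpow_le_one (ENNReal.ofReal_le_one.mpr hr1.le) hp.le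
  have hcap := (variationalCapacity_le_extensionEnergy hq hΩ hr h1 h0).trans
    (extensionEnergy_le_extensionSetFunction hq hqp ht)
  calc _ ≤ ENNReal.ofReal (r ^ (p * q)) *
        (extensionSetFunction p q Ω (Metric.ball x r) ^ ((p - q) / p) *
          sobolevEnergy p Ω u (gradient u) ^ (q / p)) ^ p := by gcongr
    _ = extensionSetFunction p q Ω (Metric.ball x r) ^ (p - q) *
        (ENNReal.ofReal r ^ p * sobolevEnergy p Ω u (gradient u)) ^ q := by
        rw [ENNReal.mul_rpow_of_nonneg _ _ hp.le, ENNReal.mul_rpow_of_nonneg _ _ hq.le,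
          ← ENNReal.rpow_mul, ← ENNReal.rpow_mul, ← ENNReal.rpow_mul,
          ENNReal.ofReal_rpow_of_pos hr, div_mul_cancel₀ _ hp.ne', div_mul_cancel₀ _ hp.ne']
        ring
    _ ≤ _ := by gcongr

theorem isBoundedMonotoneAdditive_const_mul_extensionSetFunction {p q : ℝ} {Ω : Set E}
    (hq : 0 < q) (hqp : q < p) (hΩ : IsSobolevExtensionDomain p q Ω) (c : ℝ≥0) :
    IsBoundedMonotoneAdditive fun U : Opens E => c * extensionSetFunction p q Ω U where
  bounded := by
    obtain ⟨M, hM⟩ := exists_extensionSetFunction_le hq hqp hΩ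
    refine ⟨c * M, fun U => ?_⟩
    rw [ENNReal.coe_mul]
    gcongr
    exact hM U
  monotone U V h := by
    gcongr
    exact extensionSetFunction_mono hq hqp V.isOpen.measurableSet h
  iUnion U h := by
    rw [Opens.coe_iSup, extensionSetFunction_iUnion hq hqp hΩ.isOpen.measurableSet
      (fun i => (U i).isOpen) h, ENNReal.tsum_mul_left]

end Capacity

theorem mainTheorem2 {n : ℕ} (hn : 2 ≤ n) {p q : ℝ} (hq : 1 ≤ q) (hqp : q < p)
    {Ω : Set (EuclideanSpace ℝ (Fin n))} (hΩ : IsSobolevExtensionDomain p q Ω) :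
    ∃ Φ : Opens (EuclideanSpace ℝ (Fin n)) → ℝ≥0∞, IsBoundedMonotoneAdditive Φ ∧
      ∀ x ∈ frontier Ω, ∀ r : ℝ, 0 < r → r < min 1 (Metric.diam Ω / 4) →
        ENNReal.ofReal (r ^ (p * q)) *
            variationalCapacity q (Ω ∩ Metric.ball x (r / 4))
              (Ω ∩ annulus x (r / 2) (3 * r / 4)) (Metric.ball x r) ^ p
          ≤ Φ (openBall x r) ^ (p - q) * volume (Metric.ball x r ∩ Ω) ^ q := by
  have hq0 : 0 < q := zero_lt_one.trans_le hq
  have hpq : 0 < p - q := sub_pos.mpr hqp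
  obtain ⟨C, hC⟩ := exists_extensionSetFunction_capacity_estimate n hq0 hqp
  -- The (p-q)-th power of this factor is C^q, the constant of the capacity estimate.
  refine ⟨fun U => (C ^ (q / (p - q)) : ℝ≥0) * extensionSetFunction p q Ω U,
    isBoundedMonotoneAdditive_const_mul_extensionSetFunction hq0 hqp hΩ _, ?_⟩
  intro x _ r hr hr1
  refine (hC Ω hΩ.isOpen x r hr (hr1.trans_le (min_le_left _ _))).trans_eq ?_
  rw [ENNReal.mul_rpow_of_nonneg _ _ hq0.le, ENNReal.mul_rpow_of_nonneg _ _ hpq.le,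
    ENNReal.coe_rpow_of_nonneg _ (div_pos hq0 hpq).le, ← ENNReal.rpow_mul,
    div_mul_cancel₀ _ hpq.ne']
  change extensionSetFunction p q Ω (Metric.ball x r) ^ (p - q) * _ =
    _ * extensionSetFunction p q Ω (Metric.ball x r) ^ (p - q) * _
  ring
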